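/- For $F\subseteq\mathbb{R}$ let $\mathrm{pix}(F):=\{k\in\mathbb{Z}: F\cap[k,k+1)\neq\varnothing\}$. The macroscopic Minkowski dimension of $F$ is $$\mathrm{Dim}_{\mathrm M}(F):=\limsup_{n\to\infty}\frac1n\,\log_2\Big(\max\big\{\,|\mathrm{pix}(F)\cap[-2^n,2^n)|\,,\,2\big\}\Big),$$ where $|\cdot|$ denotes cardinality. **Theorem.** Let $X=\{X_t\}_{t\ge0}$ be a subordinator, that is, a real-valued Lévy process (càdlàg, with stationary and independent increments and $X_0=0$) whose paths are a.s. nondecreasing, and assume that $\mathrm P\{X_1>0\}>0$. Let $\Phi_X:[0,\infty)\to[0,\infty)$ be its Laplace exponent, defined by $\mathrm E\,e^{-\lambda X_t}=e^{-t\Phi_X(\lambda)}$ for all $t,\lambda\ge0$, and let $\mathcal R_X:=\bigcup_{t\ge0}\{X_t\}$ be its range. Then, with $\inf\varnothing:=1$, $$\mathrm{Dim}_{\mathrm M}(\mathcal R_X)=\inf\Big\{0<\alpha<1:\ \int_0^1\frac{dy}{y^{1-\alpha}\,\Phi_X(y)}<\infty\Big\}\qquad\text{a.s.}$$ If moreover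 $\int_0^\infty \frac{dy}{y^{1-\alpha}\Phi_X(y)}<\infty$ for at least one $\alpha\in(0,1)$, then also $$\mathrm{Dim}_{\mathrm M}(\mathcal R_X)=\inf\Big\{0<\alpha<1:\ \int_0^\infty\frac{dy}{y^{1-\alpha}\,\Phi_X(y)}<\infty\Big\}\qquad\text{a.s.}$$ -/

import Mathlib

open MeasureTheory ProbabilityTheory Filter Topology
open scoped NNReal ENNReal

namespace MacroDim

noncomputable section

/-- The pixelization of `F ⊆ ℝ`: all integers `k` such that `F` meets `Q(k) = [k, k + 1)`. -/
def pix (F : Set ℝ) : Set ℤ :=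
  {k | (F ∩ Set.Ico (k : ℝ) (k + 1)).Nonempty}

/-- The integers in the box `B(0; r) = [-r, r)`. -/
def box (r : ℝ) : Set ℤ :=
  {k | (k : ℝ) ∈ Set.Ico (-r) r}

/-- `Log₊ y = log₂ (max y 2)`. -/
def logPlus (y : ℝ) : ℝ :=
  Real.logb 2 (max y 2)

/-- The macroscopic Minkowski dimension of `F ⊆ ℝ`,
`limsup_{n → ∞} n⁻¹ Log₊ |pix F ∩ B(0; 2ⁿ)|`, taken in the extended reals.
The set that is counted is always finite. -/
def dimM (F : Set ℝ) : EReal :=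
  limsup (fun n : ℕ =>
    (((n : ℝ)⁻¹ * logPlus ((pix F ∩ box (2 ^ n)).ncard : ℝ) : ℝ) : EReal)) atTop

/-- A path `[0, ∞) → ℝ` is càdlàg if it is right-continuous and has (finite) left limits. -/
def IsCadlag (f : ℝ≥0 → ℝ) : Prop :=
  (∀ t, ContinuousWithinAt f (Set.Ici t) t) ∧ ∀ t, ∃ l : ℝ, Tendsto f (𝓝[<] t) (𝓝 l)

variable {Ω : Type*} [MeasurableSpace Ω]

/-- A (real-valued) Lévy process. The strong Markov property is a consequence of the others. -/
structure IsLevyProcess (X : ℝ≥0 → Ω → ℝ) (P : Measure Ω) : Prop where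
  measurable : ∀ t, Measurable (X t)
  zero : ∀ᵐ ω ∂P, X 0 ω = 0
  indep : HasIndepIncrements X P
  stationary : ∀ s t : ℝ≥0,
    IdentDistrib (fun ω => X (s + t) ω - X s ω) (fun ω => X t ω - X 0 ω) P P
  cadlag : ∀ᵐ ω ∂P, IsCadlag (fun t => X t ω)

/-- A subordinator: a real-valued Lévy process with almost surely nondecreasing paths. -/
structure IsSubordinator (X : ℝ≥0 → Ω → ℝ) (P : Measure Ω) : Prop
    extends IsLevyProcess X P where
  monotone : ∀ᵐ ω ∂P, Monotone (fun t => X t ω)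

/-- `Φ` (a function on `[0, ∞)`; its values on negative numbers are irrelevant) is the Laplace
exponent of `X`: `E exp (-λ X_t) = exp (-t Φ(λ))` for all `t, λ ≥ 0`. -/
def IsLaplaceExponent (Φ : ℝ → ℝ) (X : ℝ≥0 → Ω → ℝ) (P : Measure Ω) : Prop :=
  ∀ (t : ℝ≥0) (l : ℝ), 0 ≤ l →
    ∫ ω, Real.exp (-(l * X t ω)) ∂P = Real.exp (-((t : ℝ) * Φ l))

/-- The set of `α ∈ (0, 1)` such that `∫_I dy / (y^{1 - α} Φ(y)) < ∞`. The integral is the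
Lebesgue integral of a `[0, ∞]`-valued function. -/
def convergenceSet (Φ : ℝ → ℝ) (I : Set ℝ) : Set ℝ :=
  {α | 0 < α ∧ α < 1 ∧
    ∫⁻ y in I, (ENNReal.ofReal (y ^ (1 - α) * Φ y))⁻¹ < ∞}

open Classical in
/-- The infimum of `A ⊆ (0, 1)`, with the convention `inf ∅ = 1`. -/
def infOrOne (A : Set ℝ) : ℝ :=
  if A.Nonempty then sInf A else 1

end

end MacroDim

/-!
Let `N n` be the number of pixels in `[0, 2 ^ n)` that the range meets. Up to factors `2 ^ (n ε)`,
`N n` is the time that the subordinator takes to pass the level `2 ^ n`, and this time is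
`1 / Φ (2 ^ (-n))`. The upper exponential growth rate of `1 / Φ (2 ^ (-n))` is the critical exponent
of the integral, because `Φ` is monotone on `[0, ∞)`. Both comparisons hold almost surely by
Borel–Cantelli arguments; neither the strong Markov property nor a zero-one law is used.

*Passage times.* Markov's inequality for `e ^ (-X_t / r)` and `1 - e ^ (-X_t / r)` bounds
`P {X_t < r}` by `3 / (t Φ(1 / r))` and `P {r ≤ X_t}` by `2 t Φ(1 / r)`
(`IsSubordinator.measureReal_lt_le`, `IsSubordinator.measureReal_ge_le`).

*Upper bound.* The number of distinct integer parts of a monotone sequence with increments `Δ` is at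
most `2 + 4 ∑ (1 - e ^ (-Δ))` (`card_image_floor_add_fract_le`). For the process sampled along a
partition of `[0, t]`, the mean of this sum is at most `t Φ(1)`, whatever the mesh. By
right-continuity a fine partition sees all the pixels counted, so Fatou's lemma shows that the
probability of meeting more than `c` pixels before time `t` is at most `(2 + 4 t Φ(1)) / c`
(`IsSubordinator.measureReal_liminf_expVariation_le`). Convergence of the integral at the exponent
`a` gives `Φ x ≥ c x ^ a` near zero, hence `dimM ≤ b` for every `b > a`
(`IsSubordinator.ae_dimM_range_le`).

*Lower bound.* If the integral diverges at `a`, then `Φ (2 ^ (-n)) ≤ 2 ^ (-n b)` for infinitely many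
`n`, for every `b < a`. By the strong law of large numbers, a positive proportion of the increments
over time steps of a suitable length is at least one, and each such increment reaches a new pixel
(`IsSubordinator.ae_le_dimM_range`).

The integral over `(0, ∞)` differs from that over `(0, 1]` by a term whose convergence at one exponent
implies convergence at all smaller ones, so the two infima agree
(`infOrOne_convergenceSet_Ioi_eq`).
-/

namespace MacroDim

/-! ### Counting the integer parts of a monotone sequence -/

/-- The expression `card + fract` grows by exactly `Δ` over a step `Δ < 1` (either the integer part
stays, or it increases by one and the fractional part changes by `Δ - 1`), and by at most `2` over a
step `Δ ≥ 1`. Both are at most `4 (1 - e ^ (-Δ))`. -/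
lemma card_image_floor_add_fract_le {a : ℕ → ℝ} (ha : Monotone a) (m : ℕ) :
    (((Finset.range (m + 1)).image fun i => ⌊a i⌋).card : ℝ) + Int.fract (a m) ≤
      2 + 4 * ∑ i ∈ Finset.range m, (1 - Real.exp (-(a (i + 1) - a i))) := by
  induction m with
  | zero =>
    have := (Int.fract_lt_one (a 0)).le
    simp only [zero_add, Finset.range_one, Finset.image_singleton, Finset.card_singleton,
      Finset.range_zero, Finset.sum_empty]
    push_cast
    linarith
  | succ m ih =>
    rw [Finset.sum_range_succ, Finset.range_add_one, Finset.image_insert]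
    set S := (Finset.range (m + 1)).image fun i => ⌊a i⌋ with hS
    have hmem : ⌊a m⌋ ∈ S := Finset.mem_image_of_mem (fun i => ⌊a i⌋) (by simp)
    have hd : 0 ≤ a (m + 1) - a m := sub_nonneg.2 (ha (Nat.le_succ m))
    set d := a (m + 1) - a m with hd'
    have hexp : Real.exp (-d) * (1 + d) ≤ 1 := by
      have h1 := Real.add_one_le_exp d
      have h2 : Real.exp (-d) * Real.exp d = 1 := by rw [← Real.exp_add]; simp
      nlinarith [Real.exp_pos (-d)]
    have hcard : ((insert ⌊a (m + 1)⌋ S).card : ℝ) ≤ S.card + 1 := by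
      exact_mod_cast Finset.card_insert_le _ _
    suffices h : ((insert ⌊a (m + 1)⌋ S).card : ℝ) + Int.fract (a (m + 1)) ≤
        S.card + Int.fract (a m) + 4 * (1 - Real.exp (-d)) by linarith
    rcases lt_or_ge d 1 with hd1 | hd1
    · have h4 : d ≤ 4 * (1 - Real.exp (-d)) := by nlinarith [Real.exp_pos (-d)]
      suffices h : ((insert ⌊a (m + 1)⌋ S).card : ℝ) + Int.fract (a (m + 1)) ≤
        S.card + Int.fract (a m) + d by linarith
      by_cases hfl : ⌊a (m + 1)⌋ = ⌊a m⌋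
      · rw [hfl, Finset.insert_eq_of_mem hmem, Int.fract, Int.fract, hfl]
        linarith
      · have hlt : ⌊a m⌋ + 1 ≤ ⌊a (m + 1)⌋ :=
          lt_of_le_of_ne (Int.floor_le_floor (ha (Nat.le_succ m))) (Ne.symm hfl)
        have : (⌊a m⌋ : ℝ) + 1 ≤ ⌊a (m + 1)⌋ := by exact_mod_cast hlt
        rw [Int.fract, Int.fract]
        linarith
    · have h4 : 2 ≤ 4 * (1 - Real.exp (-d)) := by nlinarith [Real.exp_pos (-d)]
      have := (Int.fract_lt_one (a (m + 1))).le
      have := Int.fract_nonneg (a m)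
      linarith

/-- Each step of size at least one leads to a new integer part. -/
lemma card_filter_one_le_sub_lt_card_image_floor {a : ℕ → ℝ} (ha : Monotone a) (m : ℕ) :
    ((Finset.range m).filter fun i => 1 ≤ a (i + 1) - a i).card <
      ((Finset.range (m + 1)).image fun i => ⌊a i⌋).card := by
  induction m with
  | zero => simp
  | succ m ih =>
    rw [Finset.range_add_one (n := m + 1), Finset.image_insert]
    rw [Finset.range_add_one (n := m), Finset.filter_insert]
    by_cases h : 1 ≤ a (m + 1) - a m
    · rw [if_pos h]
      have hnot : ⌊a (m + 1)⌋ ∉ (insert m (Finset.range m)).image fun i => ⌊a i⌋ := by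
        rw [← Finset.range_add_one]
        simp only [Finset.mem_image, Finset.mem_range, not_exists, not_and]
        intro i hi hfl
        have h1 : a i + 1 ≤ a (m + 1) := by linarith [ha (Nat.lt_succ_iff.1 hi)]
        have h2 := Int.floor_le_floor h1
        rw [Int.floor_add_one] at h2
        omega
      rw [← Finset.range_add_one] at hnot ⊢
      rw [Finset.card_insert_of_notMem hnot]
      exact (Finset.card_insert_le _ _).trans_lt (by omega)
    · rw [if_neg h]
      rw [← Finset.range_add_one]
      exact ih.trans_le (Finset.card_le_card (Finset.subset_insert _ _))

/-! ### Pixels of the range of a path -/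

lemma mem_pix_range_iff {f : ℝ≥0 → ℝ} {k : ℤ} : k ∈ pix (Set.range f) ↔ ∃ u, ⌊f u⌋ = k := by
  simp only [pix, Set.mem_ofPred_eq, Set.Nonempty, Set.mem_inter_iff, Set.mem_range, Set.mem_Ico,
    Int.floor_eq_iff]
  grind

lemma finite_box (r : ℝ) : (box r).Finite := by
  refine (Set.finite_Icc (-⌈r⌉) ⌈r⌉).subset fun k hk => ?_
  simp only [box, Set.mem_ofPred_eq, Set.mem_Ico] at hk
  have h1 : (k : ℝ) < ⌈r⌉ := hk.2.trans_le (Int.le_ceil r)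
  have h2 : -(⌈r⌉ : ℝ) ≤ k := by linarith [Int.le_ceil r]
  exact ⟨by exact_mod_cast h2, by exact_mod_cast h1.le⟩

/-- A bounded substitute for the variation of `f` on `[0, t]`: the sum of `1 - e ^ (-Δ)` over the
increments `Δ` of `f` along the partition of `[0, t]` into `j + 1` intervals of equal length. -/
noncomputable def expVariation (f : ℝ≥0 → ℝ) (t : ℝ≥0) (j : ℕ) : ℝ :=
  ∑ i ∈ Finset.range (j + 1),
    (1 - Real.exp (-(f (((i + 1 : ℕ) : ℝ≥0) * (t / (j + 1))) - f ((i : ℝ≥0) * (t / (j + 1))))))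

/-- Right-continuity makes the visit to a pixel last for a positive time, so that it is seen along
every sufficiently fine partition. -/
lemma eventually_exists_floor_eq {f : ℝ≥0 → ℝ} (hf : Monotone f)
    (hc : ∀ t, ContinuousWithinAt f (Set.Ici t) t) {u t : ℝ≥0} (hut : u < t) :
    ∀ᶠ j : ℕ in atTop, ∃ i ≤ j + 1, ⌊f ((i : ℝ≥0) * (t / (j + 1)))⌋ = ⌊f u⌋ := by
  have h1 : ∀ᶠ v in 𝓝[≥] u, f v < ⌊f u⌋ + 1 :=
    (hc u).eventually_lt tendsto_const_nhds (Int.lt_floor_add_one (f u))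
  obtain ⟨v, huv, hv⟩ := (mem_nhdsGE_iff_exists_Ico_subset' hut).1 h1
  have h0 : Tendsto (fun j : ℕ => u + t / ((j : ℝ≥0) + 1)) atTop (𝓝 u) := by
    have : Tendsto (fun j : ℕ => t / ((j : ℝ≥0) + 1)) atTop (𝓝 0) := by
      rw [← NNReal.tendsto_coe]
      refine ((tendsto_const_div_atTop_nhds_zero_nat (t : ℝ)).comp
        (tendsto_add_atTop_nat 1)).congr fun j => ?_
      simp
    simpa using tendsto_const_nhds.add this
  filter_upwards [h0.eventually_lt_const huv] with j hj
  have ht : 0 < t := (zero_le).trans_lt hut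
  set δ := t / ((j : ℝ≥0) + 1) with hδ
  have hδ0 : 0 < δ := by positivity
  have hle : u ≤ (⌈u / δ⌉₊ : ℝ≥0) * δ := by
    have := Nat.le_ceil (u / δ)
    rwa [div_le_iff₀ hδ0] at this
  have hlt : (⌈u / δ⌉₊ : ℝ≥0) * δ < u + δ := by
    have := Nat.ceil_lt_add_one (zero_le (a := u / δ))
    have h := mul_lt_mul_of_pos_right this hδ0
    rwa [add_mul, div_mul_cancel₀ _ hδ0.ne', one_mul] at h
  refine ⟨⌈u / δ⌉₊, ?_, ?_⟩
  · rw [Nat.ceil_le, div_le_iff₀ hδ0, hδ]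
    push_cast
    rw [mul_div_cancel₀ _ (by positivity)]
    exact hut.le
  · rw [Int.floor_eq_iff]
    exact ⟨(Int.floor_le _).trans (hf hle), hv ⟨hle, hlt.trans hj⟩⟩

/-- If `2 ^ n ≤ f t`, then all pixels in `[0, 2 ^ n)` that `f` ever visits are visited before `t`,
and their number is controlled along fine partitions of `[0, t]`. -/
lemma eventually_ncard_le {f : ℝ≥0 → ℝ} (hf : Monotone f)
    (hc : ∀ t, ContinuousWithinAt f (Set.Ici t) t) {t : ℝ≥0} {n : ℕ}
    (ht : 2 ^ n ≤ f t) :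
    ∀ᶠ j : ℕ in atTop,
      ((pix (Set.range f) ∩ box (2 ^ n)).ncard : ℝ) ≤ 2 + 4 * expVariation f t j := by
  have hfin : (pix (Set.range f) ∩ box (2 ^ n)).Finite := (finite_box _).inter_of_right _
  have hev : ∀ᶠ j : ℕ in atTop, ∀ k ∈ pix (Set.range f) ∩ box (2 ^ n),
      ∃ i ≤ j + 1, ⌊f ((i : ℝ≥0) * (t / (j + 1)))⌋ = k := by
    rw [hfin.eventually_all]
    rintro k ⟨hk, hkb⟩
    obtain ⟨u, rfl⟩ := mem_pix_range_iff.1 hk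
    refine eventually_exists_floor_eq hf hc ?_
    by_contra hlt
    have h1 : (2 : ℝ) ^ n ≤ f u := ht.trans (hf (not_lt.1 hlt))
    have h2 : ((2 ^ n : ℤ) : ℝ) ≤ f u := by push_cast; exact h1
    have h3 : (2 ^ n : ℤ) ≤ ⌊f u⌋ := Int.le_floor.2 h2
    have h4 : ((2 ^ n : ℤ) : ℝ) ≤ ⌊f u⌋ := by exact_mod_cast h3
    push_cast at h4
    exact absurd hkb.2 (not_lt.2 h4)
  filter_upwards [hev] with j hj
  have ha : Monotone fun i : ℕ => f ((i : ℝ≥0) * (t / (j + 1))) := by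
    intro i i' hii
    exact hf (mul_le_mul_left (by exact_mod_cast hii) _)
  have hle := card_image_floor_add_fract_le ha (j + 1)
  have hsub : pix (Set.range f) ∩ box (2 ^ n) ⊆
      (Finset.range (j + 1 + 1)).image fun i : ℕ => ⌊f ((i : ℝ≥0) * (t / (j + 1)))⌋ := by
    intro k hk
    obtain ⟨i, hi, rfl⟩ := hj k hk
    simp only [Finset.coe_image, Set.mem_image, Finset.coe_range, Set.mem_Iio]
    exact ⟨i, by omega, rfl⟩
  have hcard := Set.ncard_le_ncard hsub (Finset.finite_toSet _)
  rw [Set.ncard_coe_finset] at hcard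
  have hcard' : ((pix (Set.range f) ∩ box (2 ^ n)).ncard : ℝ) ≤ _ := Nat.cast_le.2 hcard
  have := Int.fract_nonneg (f (((j + 1 : ℕ) : ℝ≥0) * (t / (j + 1))))
  unfold expVariation
  linarith

/-- Jumps of size at least one along an arithmetic progression of times lead to distinct pixels. -/
lemma card_filter_le_ncard {f : ℝ≥0 → ℝ} (hf : Monotone f) (h0 : 0 ≤ f 0) {s : ℝ≥0} {m n : ℕ}
    (hlt : f ((m : ℝ≥0) * s) < 2 ^ n) :
    ((Finset.range m).filter fun i : ℕ =>
        1 ≤ f (((i + 1 : ℕ) : ℝ≥0) * s) - f ((i : ℝ≥0) * s)).card ≤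
      (pix (Set.range f) ∩ box (2 ^ n)).ncard := by
  have ha : Monotone fun i : ℕ => f ((i : ℝ≥0) * s) := by
    intro i i' hii
    exact hf (mul_le_mul_left (by exact_mod_cast hii) _)
  refine (card_filter_one_le_sub_lt_card_image_floor ha m).le.trans ?_
  rw [← Set.ncard_coe_finset]
  refine Set.ncard_le_ncard ?_ ((finite_box _).inter_of_right _)
  intro k hk
  simp only [Finset.coe_image, Set.mem_image, Finset.coe_range, Set.mem_Iio] at hk
  obtain ⟨i, hi, rfl⟩ := hk
  refine ⟨mem_pix_range_iff.2 ⟨_, rfl⟩, ?_, ?_⟩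
  · have h1 : 0 ≤ ⌊f ((i : ℝ≥0) * s)⌋ := Int.floor_nonneg.2 (h0.trans (hf zero_le))
    have h2 : (0 : ℝ) ≤ ⌊f ((i : ℝ≥0) * s)⌋ := by exact_mod_cast h1
    exact le_trans (by simp) h2
  · exact (Int.floor_le _).trans_lt ((ha (by omega : i ≤ m)).trans_lt hlt)

/-! ### The Laplace exponent and the increments of a subordinator -/

variable {Ω : Type*} [MeasurableSpace Ω] {P : Measure Ω} {X : ℝ≥0 → Ω → ℝ}
  {Φ : ℝ → ℝ}

lemma IsSubordinator.ae_nonneg (hX : IsSubordinator X P) (t : ℝ≥0) : ∀ᵐ ω ∂P, 0 ≤ X t ω := by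
  filter_upwards [hX.zero, hX.monotone] with ω h0 hm
  rw [← h0]
  exact hm zero_le

lemma IsSubordinator.integral_exp_sub (hX : IsSubordinator X P) (hΦ : IsLaplaceExponent Φ X P)
    (s d : ℝ≥0) :
    ∫ ω, Real.exp (-(X (s + d) ω - X s ω)) ∂P = Real.exp (-((d : ℝ) * Φ 1)) := by
  have hu : Measurable fun x : ℝ => Real.exp (-x) := by fun_prop
  have h1 := ((hX.stationary s d).comp hu).integral_eq
  simp only [Function.comp_def] at h1
  rw [h1, ← hΦ d 1 zero_le_one]
  refine integral_congr_ae ?_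
  filter_upwards [hX.zero] with ω h0
  rw [h0]
  simp

variable [IsProbabilityMeasure P]

lemma ae_eventually_notMem_of_summable {s : ℕ → Set Ω} {b : ℕ → ℝ}
    (h : ∀ n, P.real (s n) ≤ b n) (hb : Summable b) : ∀ᵐ ω ∂P, ∀ᶠ n in atTop, ω ∉ s n := by
  refine ae_eventually_notMem (ne_of_lt ?_)
  calc ∑' n, P (s n) ≤ ∑' n, ENNReal.ofReal (b n) := by
        refine ENNReal.tsum_le_tsum fun n => ?_
        rw [← ofReal_measureReal]
        exact ENNReal.ofReal_le_ofReal (h n)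
    _ < ∞ := hb.tsum_ofReal_lt_top

lemma IsSubordinator.integrable_exp (hX : IsSubordinator X P) (t : ℝ≥0) {l : ℝ} (hl : 0 ≤ l) :
    Integrable (fun ω => Real.exp (-(l * X t ω))) P := by
  refine Integrable.of_bound (C := 1) ?_ ?_
  · exact (((hX.measurable t).const_mul l).neg.exp).aestronglyMeasurable
  · filter_upwards [hX.ae_nonneg t] with ω hω
    rw [Real.norm_eq_abs, Real.abs_exp, Real.exp_le_one_iff]
    have := mul_nonneg hl hω
    linarith

lemma IsSubordinator.integrable_exp_sub (hX : IsSubordinator X P) {s t : ℝ≥0} (hst : s ≤ t) :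
    Integrable (fun ω => Real.exp (-(X t ω - X s ω))) P := by
  refine Integrable.of_bound (C := 1) ?_ ?_
  · exact (((hX.measurable t).sub (hX.measurable s)).neg.exp).aestronglyMeasurable
  · filter_upwards [hX.monotone] with ω hω
    rw [Real.norm_eq_abs, Real.abs_exp, Real.exp_le_one_iff]
    have := hω hst
    simp only at this
    linarith

lemma IsSubordinator.laplace_mono (hX : IsSubordinator X P) (hΦ : IsLaplaceExponent Φ X P)
    {l l' : ℝ} (hl : 0 ≤ l) (hll : l ≤ l') : Φ l ≤ Φ l' := by
  have h1 := hΦ 1 l hl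
  have h2 := hΦ 1 l' (hl.trans hll)
  have h : ∫ ω, Real.exp (-(l' * X 1 ω)) ∂P ≤ ∫ ω, Real.exp (-(l * X 1 ω)) ∂P := by
    refine integral_mono_ae (hX.integrable_exp 1 (hl.trans hll)) (hX.integrable_exp 1 hl) ?_
    filter_upwards [hX.ae_nonneg 1] with ω hω
    exact Real.exp_le_exp.2 (neg_le_neg (mul_le_mul_of_nonneg_right hll hω))
  rw [h1, h2, Real.exp_le_exp] at h
  simpa using h

lemma IsSubordinator.laplace_pos (hX : IsSubordinator X P) (hΦ : IsLaplaceExponent Φ X P)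
    (hpos : 0 < P {ω | 0 < X 1 ω}) {l : ℝ} (hl : 0 < l) : 0 < Φ l := by
  have hint : Integrable (fun ω => 1 - Real.exp (-(l * X 1 ω))) P :=
    (integrable_const 1).sub (hX.integrable_exp 1 hl.le)
  have h : 0 < ∫ ω, (1 - Real.exp (-(l * X 1 ω))) ∂P := by
    rw [integral_pos_iff_support_of_nonneg_ae ?_ hint]
    · refine hpos.trans_le (measure_mono fun ω hω => ?_)
      have : Real.exp (-(l * X 1 ω)) < 1 := by
        rw [Real.exp_lt_one_iff]
        exact neg_lt_zero.2 (mul_pos hl hω)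
      exact (sub_pos.2 this).ne'
    · filter_upwards [hX.ae_nonneg 1] with ω hω
      have : Real.exp (-(l * X 1 ω)) ≤ 1 := by
        rw [Real.exp_le_one_iff]
        exact neg_nonpos.2 (mul_nonneg hl.le hω)
      exact sub_nonneg.2 this
  rw [integral_sub (integrable_const 1) (hX.integrable_exp 1 hl.le), hΦ 1 l hl.le] at h
  simp only [integral_const, probReal_univ, smul_eq_mul, mul_one, NNReal.coe_one, one_mul,
    sub_pos, Real.exp_lt_one_iff] at h
  linarith

/-- Markov's inequality for `e ^ (-X_t / r)`. The exponential bound `e * e ^ (-t Φ(1 / r))` that it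
gives is weakened by `e ^ (-y) ≤ 1 / y`, which is enough for summability along dyadic levels. -/
lemma IsSubordinator.measureReal_lt_le (hX : IsSubordinator X P) (hΦ : IsLaplaceExponent Φ X P)
    (hpos : 0 < P {ω | 0 < X 1 ω}) {t : ℝ≥0} (ht : 0 < t) {r : ℝ} (hr : 0 < r) :
    P.real {ω | X t ω < r} ≤ 3 / (t * Φ r⁻¹) := by
  have hl : 0 < r⁻¹ := inv_pos.2 hr
  have hΦ0 := hX.laplace_pos hΦ hpos hl
  have ht' : (0 : ℝ) < t := by exact_mod_cast ht
  have hm := mul_meas_ge_le_integral_of_nonneg (μ := P)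
    (Eventually.of_forall fun ω => (Real.exp_pos (-(r⁻¹ * X t ω))).le)
    (hX.integrable_exp t hl.le) (Real.exp (-1))
  rw [hΦ t _ hl.le] at hm
  have hsub : P.real {ω | X t ω < r} ≤ P.real {ω | Real.exp (-1) ≤ Real.exp (-(r⁻¹ * X t ω))} := by
    refine measureReal_mono fun ω hω => ?_
    refine Real.exp_le_exp.2 (neg_le_neg ?_)
    rw [inv_mul_le_one₀ hr]
    exact le_of_lt hω
  set q := P.real {ω | X t ω < r}
  set y := (t : ℝ) * Φ r⁻¹
  have hy : 0 < y := mul_pos ht' hΦ0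
  have h1 : Real.exp (-1) * q ≤ Real.exp (-y) :=
    (mul_le_mul_of_nonneg_left hsub (Real.exp_pos _).le).trans hm
  have h2 : q ≤ Real.exp 1 * Real.exp (-y) := by
    have := mul_le_mul_of_nonneg_left h1 (Real.exp_pos 1).le
    rwa [← mul_assoc, ← Real.exp_add, add_neg_cancel, Real.exp_zero, one_mul] at this
  have h3 : y * Real.exp (-y) ≤ 1 := by
    have h5 := Real.add_one_le_exp y
    have h6 : Real.exp (-y) * Real.exp y = 1 := by rw [← Real.exp_add]; simp
    nlinarith [Real.exp_pos (-y)]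
  rw [le_div_iff₀ hy]
  have he := Real.exp_one_lt_d9
  calc q * y ≤ Real.exp 1 * Real.exp (-y) * y := mul_le_mul_of_nonneg_right h2 hy.le
    _ = Real.exp 1 * (y * Real.exp (-y)) := by ring
    _ ≤ Real.exp 1 * 1 := mul_le_mul_of_nonneg_left h3 (Real.exp_pos 1).le
    _ ≤ 3 := by linarith

/-- Markov's inequality for `1 - e ^ (-X_t / r)`. -/
lemma IsSubordinator.measureReal_ge_le (hX : IsSubordinator X P) (hΦ : IsLaplaceExponent Φ X P)
    (t : ℝ≥0) {r : ℝ} (hr : 0 < r) :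
    P.real {ω | r ≤ X t ω} ≤ 2 * (t * Φ r⁻¹) := by
  have hl : 0 < r⁻¹ := inv_pos.2 hr
  have hnn : 0 ≤ᵐ[P] fun ω => 1 - Real.exp (-(r⁻¹ * X t ω)) := by
    filter_upwards [hX.ae_nonneg t] with ω hω
    have : Real.exp (-(r⁻¹ * X t ω)) ≤ 1 := by
      rw [Real.exp_le_one_iff]
      exact neg_nonpos.2 (mul_nonneg hl.le hω)
    exact sub_nonneg.2 this
  have hm := mul_meas_ge_le_integral_of_nonneg hnn
    ((integrable_const 1).sub (hX.integrable_exp t hl.le)) (1 / 2)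
  rw [integral_sub (integrable_const 1) (hX.integrable_exp t hl.le), hΦ t _ hl.le] at hm
  simp only [integral_const, probReal_univ, smul_eq_mul, mul_one] at hm
  have hsub : P.real {ω | r ≤ X t ω} ≤ P.real {ω | 1 / 2 ≤ 1 - Real.exp (-(r⁻¹ * X t ω))} := by
    refine measureReal_mono fun ω hω => ?_
    have h1 : (1 : ℝ) ≤ r⁻¹ * X t ω := by
      rw [inv_mul_eq_div, one_le_div hr]
      exact hω
    have h2 : Real.exp (-(r⁻¹ * X t ω)) ≤ Real.exp (-1) := Real.exp_le_exp.2 (neg_le_neg h1)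
    have h3 := Real.exp_neg_one_lt_d9
    change (1 / 2 : ℝ) ≤ _
    linarith
  have := Real.add_one_le_exp (-((t : ℝ) * Φ r⁻¹))
  linarith

/-- The mean of the exponential variation on `[0, t]` is bounded uniformly in the mesh. -/
lemma IsSubordinator.lintegral_expVariation_le (hX : IsSubordinator X P)
    (hΦ : IsLaplaceExponent Φ X P) (t : ℝ≥0) (j : ℕ) :
    ∫⁻ ω, ENNReal.ofReal (2 + 4 * expVariation (fun u => X u ω) t j) ∂P ≤
      ENNReal.ofReal (2 + 4 * (t * Φ 1)) := by
  set δ : ℝ≥0 := t / (j + 1) with hδ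
  have hint : ∀ i : ℕ, Integrable (fun ω =>
      Real.exp (-(X (((i + 1 : ℕ) : ℝ≥0) * δ) ω - X ((i : ℝ≥0) * δ) ω))) P := fun i =>
    hX.integrable_exp_sub (mul_le_mul_left (by exact_mod_cast Nat.le_succ i) _)
  have hint1 : ∀ i ∈ Finset.range (j + 1), Integrable (fun ω =>
      1 - Real.exp (-(X (((i + 1 : ℕ) : ℝ≥0) * δ) ω - X ((i : ℝ≥0) * δ) ω))) P := fun i _ =>
    (integrable_const 1).sub (hint i)
  have hint' : Integrable (fun ω => expVariation (fun u => X u ω) t j) P :=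
    integrable_finsetSum _ hint1
  have hnn : 0 ≤ᵐ[P] fun ω => 2 + 4 * expVariation (fun u => X u ω) t j := by
    filter_upwards [hX.monotone] with ω hm
    have : 0 ≤ expVariation (fun u => X u ω) t j := by
      refine Finset.sum_nonneg fun i _ => sub_nonneg.2 ?_
      rw [Real.exp_le_one_iff, neg_nonpos, sub_nonneg]
      exact hm (mul_le_mul_left (by exact_mod_cast Nat.le_succ i) _)
    show (0 : ℝ) ≤ 2 + 4 * expVariation (fun u => X u ω) t j
    linarith
  have hint2 : Integrable (fun ω => 2 + 4 * expVariation (fun u => X u ω) t j) P :=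
    (integrable_const 2).add (hint'.const_mul 4)
  rw [← ofReal_integral_eq_lintegral_ofReal hint2 hnn]
  refine ENNReal.ofReal_le_ofReal ?_
  rw [integral_add (integrable_const 2) (hint'.const_mul 4), integral_const_mul]
  simp only [integral_const, probReal_univ, smul_eq_mul, one_mul]
  suffices h : ∫ ω, expVariation (fun u => X u ω) t j ∂P ≤ t * Φ 1 by linarith
  unfold expVariation
  rw [integral_finsetSum _ hint1]
  have hi : ∀ i : ℕ, ∫ ω, (1 - Real.exp (-(X (((i + 1 : ℕ) : ℝ≥0) * δ) ω - X ((i : ℝ≥0) * δ) ω))) ∂P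
      ≤ δ * Φ 1 := by
    intro i
    have he : ((i + 1 : ℕ) : ℝ≥0) * δ = (i : ℝ≥0) * δ + δ := by push_cast; ring
    rw [integral_sub (integrable_const 1) (hint i), he, hX.integral_exp_sub hΦ]
    simp only [integral_const, probReal_univ, smul_eq_mul, one_mul]
    have := Real.add_one_le_exp (-((δ : ℝ) * Φ 1))
    linarith
  refine (Finset.sum_le_sum fun i _ => hi i).trans (le_of_eq ?_)
  rw [Finset.sum_const, Finset.card_range, hδ, nsmul_eq_mul]
  push_cast
  field_simp

/-- Fatou's lemma, as the mesh tends to zero, followed by Markov's inequality. -/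
lemma IsSubordinator.measureReal_liminf_expVariation_le (hX : IsSubordinator X P)
    (hΦ : IsLaplaceExponent Φ X P) (hΦ1 : 0 ≤ Φ 1) (t : ℝ≥0) {c : ℝ} (hc : 0 < c) :
    P.real {ω | ENNReal.ofReal c ≤ liminf (fun j =>
        ENNReal.ofReal (2 + 4 * expVariation (fun u => X u ω) t j)) atTop} ≤
      (2 + 4 * (t * Φ 1)) / c := by
  have hmeas : ∀ j, Measurable fun ω =>
      ENNReal.ofReal (2 + 4 * expVariation (fun u => X u ω) t j) := by
    intro j
    have : Measurable fun ω => expVariation (fun u => X u ω) t j := by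
      refine Finset.measurable_fun_sum _ fun i _ => ?_
      exact (((hX.measurable _).sub (hX.measurable _)).neg.exp).const_sub 1
    exact ((this.const_mul 4).const_add 2).ennreal_ofReal
  have hfatou := (lintegral_liminf_le (μ := P) (u := atTop) hmeas).trans
    (liminf_le_of_le (by isBoundedDefault) (a := ENNReal.ofReal (2 + 4 * (t * Φ 1))) fun b hb => by
      obtain ⟨j, hj⟩ := hb.exists
      exact hj.trans (hX.lintegral_expVariation_le hΦ t j))
  have hm := meas_ge_le_lintegral_div (μ := P) (Measurable.liminf hmeas).aemeasurable
    (ENNReal.ofReal_pos.2 hc).ne' ENNReal.ofReal_ne_top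
  have hb : (0 : ℝ) ≤ 2 + 4 * ((t : ℝ) * Φ 1) := by positivity
  refine ENNReal.toReal_le_of_le_ofReal (div_nonneg hb hc.le) (hm.trans ?_)
  rw [ENNReal.ofReal_div_of_pos hc]
  exact ENNReal.div_le_div_right hfatou _

lemma IsSubordinator.exists_measureReal_one_le_sub_pos (hX : IsSubordinator X P)
    (hΦ : IsLaplaceExponent Φ X P) (hΦ1 : 0 < Φ 1) :
    ∃ s : ℝ≥0, 0 < P.real {ω | 1 ≤ X s ω - X 0 ω} := by
  by_contra! h
  -- If `X_s - X_0 < 1` almost surely, then `e ^ (-s Φ(1)) ≥ e ^ (-1)`; this fails for `s = 2 / Φ(1)`.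
  set s : ℝ≥0 := Real.toNNReal (2 / Φ 1) with hs
  have hs' : (s : ℝ) * Φ 1 = 2 := by
    rw [hs, Real.coe_toNNReal _ (by positivity)]
    field_simp
  have h0 : ∀ᵐ ω ∂P, X s ω - X 0 ω < 1 := by
    have h1 : P.real {ω | 1 ≤ X s ω - X 0 ω} = 0 := le_antisymm (h s) measureReal_nonneg
    rw [measureReal_eq_zero_iff] at h1
    refine (measure_eq_zero_iff_ae_notMem.1 h1).mono fun ω hω => ?_
    exact not_le.1 hω
  have h2 : Real.exp (-1) ≤ Real.exp (-((s : ℝ) * Φ 1)) := by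
    rw [← hX.integral_exp_sub hΦ 0 s, zero_add]
    calc Real.exp (-1) = ∫ _ω, Real.exp (-1) ∂P := by simp
      _ ≤ _ := by
        refine integral_mono_ae (integrable_const _) (hX.integrable_exp_sub zero_le) ?_
        filter_upwards [h0] with ω hω
        exact Real.exp_le_exp.2 (neg_le_neg hω.le)
  rw [hs', Real.exp_le_exp] at h2
  norm_num at h2

/-- The strong law of large numbers for the number of increments of size at least one. -/
lemma IsSubordinator.ae_tendsto_card_filter_div (hX : IsSubordinator X P) (s : ℝ≥0) :
    ∀ᵐ ω ∂P, Tendsto (fun m : ℕ => (((Finset.range m).filter fun i : ℕ =>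
        1 ≤ X (((i + 1 : ℕ) : ℝ≥0) * s) ω - X ((i : ℝ≥0) * s) ω).card : ℝ) / m) atTop
      (𝓝 (P.real {ω | 1 ≤ X s ω - X 0 ω})) := by
  set g : ℝ → ℝ := (Set.Ici (1 : ℝ)).indicator 1 with hg
  have hgm : Measurable g := measurable_one.indicator measurableSet_Ici
  set D : ℕ → Ω → ℝ := fun i ω => X (((i + 1 : ℕ) : ℝ≥0) * s) ω - X ((i : ℝ≥0) * s) ω with hD
  have hD0 : D 0 = fun ω => X s ω - X 0 ω := by simp [hD]
  have hDm : ∀ i, Measurable (D i) := fun i => (hX.measurable _).sub (hX.measurable _)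
  have hid : ∀ i, IdentDistrib (D i) (D 0) P P := by
    intro i
    rw [hD0]
    have := hX.stationary ((i : ℝ≥0) * s) s
    convert this using 3
    push_cast
    ring_nf
  have hind : iIndepFun D P := hX.indep.nat (t := fun i : ℕ => (i : ℝ≥0) * s) fun i i' hii =>
    mul_le_mul_left (by exact_mod_cast hii) _
  have hslln := strong_law_ae_real (μ := P) (fun i => g ∘ D i) ?_ ?_ fun i => (hid i).comp hgm
  · have hmean : P[g ∘ D 0] = P.real {ω | 1 ≤ X s ω - X 0 ω} := by
      have : g ∘ D 0 = {ω | 1 ≤ X s ω - X 0 ω}.indicator 1 := by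
        rw [hD0]
        ext ω
        simp [hg, Set.indicator_apply]
      rw [this, integral_indicator_one]
      exact measurableSet_le measurable_const ((hX.measurable s).sub (hX.measurable 0))
    filter_upwards [hslln] with ω hω
    rw [hmean] at hω
    refine hω.congr fun m => ?_
    congr 1
    rw [Finset.card_filter]
    push_cast
    refine Finset.sum_congr rfl fun i _ => ?_
    simp [hg, hD, Set.indicator_apply]
  · refine Integrable.of_bound (C := 1) (hgm.comp (hDm 0)).aestronglyMeasurable ?_
    refine Eventually.of_forall fun ω => ?_
    simp only [hg, Function.comp, Set.indicator_apply, Pi.one_apply]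
    split_ifs <;> simp
  · intro i i' hii
    exact (hind.indepFun hii).comp hgm hgm

/-! ### The convergence set and the growth of the exponent at zero -/

lemma infOrOne_le_one {A : Set ℝ} (hA : ∀ a ∈ A, 0 < a ∧ a < 1) : infOrOne A ≤ 1 := by
  unfold infOrOne
  split_ifs with h
  · obtain ⟨a, ha⟩ := h
    exact (csInf_le ⟨0, fun x hx => (hA x hx).1.le⟩ ha).trans (hA a ha).2.le
  · exact le_rfl

lemma infOrOne_le_of_mem {A : Set ℝ} (hA : ∀ a ∈ A, 0 < a ∧ a < 1) {a : ℝ} (ha : a ∈ A) :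
    infOrOne A ≤ a := by
  rw [infOrOne, if_pos ⟨a, ha⟩]
  exact csInf_le ⟨0, fun x hx => (hA x hx).1.le⟩ ha

lemma exists_mem_lt_or_one_lt_of_infOrOne_lt {A : Set ℝ} {q : ℝ} (h : infOrOne A < q) :
    (∃ a ∈ A, a < q) ∨ 1 < q := by
  unfold infOrOne at h
  split_ifs at h with hA
  · exact Or.inl (exists_lt_of_csInf_lt hA h)
  · exact Or.inr h

lemma convergenceSet_subset {Φ : ℝ → ℝ} {I : Set ℝ} {a : ℝ} (ha : a ∈ convergenceSet Φ I) :
    0 < a ∧ a < 1 := ⟨ha.1, ha.2.1⟩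

/-- Convergence of the integral forces a power lower bound, by monotonicity of the integrand on
`(x / 2, x]`. -/
lemma exists_mul_rpow_le_of_mem_convergenceSet {Φ : ℝ → ℝ}
    (hmono : ∀ l l', 0 ≤ l → l ≤ l' → Φ l ≤ Φ l') (hpos : ∀ l, 0 < l → 0 < Φ l) {a : ℝ}
    (ha : a ∈ convergenceSet Φ (Set.Ioc 0 1)) :
    ∃ c > 0, ∀ x, 0 < x → x ≤ 1 → c * x ^ a ≤ Φ x := by
  obtain ⟨_, ha1, hJ⟩ := ha
  set J := ∫⁻ y in Set.Ioc 0 1, (ENNReal.ofReal (y ^ (1 - a) * Φ y))⁻¹ with hJdef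
  have hJ0 : 0 ≤ J.toReal := ENNReal.toReal_nonneg
  refine ⟨(2 * (J.toReal + 1))⁻¹, by positivity, fun x hx hx1 => ?_⟩
  have hg : 0 < x ^ (1 - a) * Φ x := mul_pos (Real.rpow_pos_of_pos hx _) (hpos x hx)
  have h1 : (ENNReal.ofReal (x ^ (1 - a) * Φ x))⁻¹ * ENNReal.ofReal (x / 2) ≤ J := by
    calc (ENNReal.ofReal (x ^ (1 - a) * Φ x))⁻¹ * ENNReal.ofReal (x / 2)
        = ∫⁻ _ in Set.Ioc (x / 2) x, (ENNReal.ofReal (x ^ (1 - a) * Φ x))⁻¹ := by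
          rw [setLIntegral_const, Real.volume_Ioc, sub_half]
      _ ≤ ∫⁻ y in Set.Ioc (x / 2) x, (ENNReal.ofReal (y ^ (1 - a) * Φ y))⁻¹ := by
          refine setLIntegral_mono' measurableSet_Ioc fun y hy => ?_
          have hy0 : 0 < y := (half_pos hx).trans hy.1
          refine ENNReal.inv_le_inv.2 (ENNReal.ofReal_le_ofReal ?_)
          exact mul_le_mul (Real.rpow_le_rpow hy0.le hy.2 (by linarith))
            (hmono y x hy0.le hy.2) (hpos y hy0).le (Real.rpow_nonneg hx.le _)
      _ ≤ J := lintegral_mono_set (Set.Ioc_subset_Ioc (by positivity) hx1)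
  rw [← ENNReal.ofReal_inv_of_pos hg, ← ENNReal.ofReal_mul (inv_nonneg.2 hg.le),
    ENNReal.ofReal_le_iff_le_toReal hJ.ne, inv_mul_le_iff₀ hg] at h1
  have h2 : x = x ^ (1 - a) * x ^ a := by
    rw [← Real.rpow_add hx]
    simp
  have h3 : 0 < x ^ (1 - a) := Real.rpow_pos_of_pos hx _
  rw [inv_mul_le_iff₀ (by positivity)]
  refine le_of_mul_le_mul_left ?_ h3
  nlinarith

lemma mem_convergenceSet_of_mul_rpow_le {Φ : ℝ → ℝ} {a b c : ℝ} (ha0 : 0 < a) (ha1 : a < 1)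
    (hba : b < a) (hc : 0 < c) (h : ∀ x, 0 < x → x ≤ 1 → c * x ^ b ≤ Φ x) :
    a ∈ convergenceSet Φ (Set.Ioc 0 1) := by
  refine ⟨ha0, ha1, ?_⟩
  have hint : IntegrableOn (fun x : ℝ => c⁻¹ * x ^ (a - 1 - b)) (Set.Ioc 0 1) := by
    have := intervalIntegral.intervalIntegrable_rpow' (a := 0) (b := 1) (r := a - 1 - b)
      (by linarith)
    rw [intervalIntegrable_iff_integrableOn_Ioc_of_le zero_le_one] at this
    exact this.const_mul c⁻¹
  refine lt_of_le_of_lt ?_ hint.lintegral_lt_top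
  refine setLIntegral_mono' measurableSet_Ioc fun x hx => ?_
  have hx1 : 0 < x ^ (1 - a) := Real.rpow_pos_of_pos hx.1 _
  have hxb : 0 < x ^ b := Real.rpow_pos_of_pos hx.1 _
  have hle := h x hx.1 hx.2
  have hΦ : 0 < Φ x := (mul_pos hc hxb).trans_le hle
  rw [← ENNReal.ofReal_inv_of_pos (mul_pos hx1 hΦ)]
  refine ENNReal.ofReal_le_ofReal ?_
  have he : c⁻¹ * x ^ (a - 1 - b) = (x ^ (1 - a) * (c * x ^ b))⁻¹ := by
    rw [show a - 1 - b = -(1 - a + b) by ring, Real.rpow_neg hx.1.le, Real.rpow_add hx.1]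
    field_simp
  rw [he]
  exact inv_anti₀ (by positivity) (mul_le_mul_of_nonneg_left hle hx1.le)

lemma frequently_le_of_notMem_convergenceSet {Φ : ℝ → ℝ}
    (hmono : ∀ l l', 0 ≤ l → l ≤ l' → Φ l ≤ Φ l') (hpos : ∀ l, 0 < l → 0 < Φ l) {a b : ℝ}
    (hb0 : 0 < b) (hba : b < a) (ha1 : a < 1) (ha : a ∉ convergenceSet Φ (Set.Ioc 0 1)) :
    ∃ᶠ n : ℕ in atTop, Φ ((2 : ℝ) ^ n)⁻¹ ≤ (((2 : ℝ) ^ n) ^ b)⁻¹ := by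
  by_contra hfreq
  rw [not_frequently] at hfreq
  obtain ⟨N, hN⟩ := eventually_atTop.1 hfreq
  have hy : ∀ n : ℕ, (0 : ℝ) < ((2 : ℝ) ^ n)⁻¹ := fun n => by positivity
  have hb2 : 0 < (1 / 2 : ℝ) ^ b := by positivity
  -- A lower bound at all small dyadic points extends, by monotonicity, to a lower bound on `(0, 1]`.
  refine ha (mem_convergenceSet_of_mul_rpow_le (hb0.trans hba) ha1 hba
    (lt_min hb2 (hpos _ (hy N))) fun x hx0 hx1 => ?_)
  have hxb : 0 < x ^ b := Real.rpow_pos_of_pos hx0 _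
  rcases le_or_gt x ((2 : ℝ) ^ N)⁻¹ with hxN | hxN
  · obtain ⟨n, hn1, hn2⟩ := exists_nat_pow_near_of_lt_one hx0 hx1 (y := (1 / 2 : ℝ))
      (by norm_num) (by norm_num)
    simp only [one_div, inv_pow] at hn1 hn2
    have hNn : N ≤ n + 1 := by
      by_contra hlt
      have h1 : ((2 : ℝ) ^ N)⁻¹ ≤ (2 ^ (n + 1))⁻¹ :=
        inv_anti₀ (by positivity) (pow_le_pow_right₀ (by norm_num) (by omega))
      linarith
    have h1 := not_le.1 (hN (n + 1) hNn)
    have h2 := hmono _ _ (hy (n + 1)).le hn1.le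
    have h3 : (1 / 2 * x) ^ b ≤ (((2 : ℝ) ^ (n + 1)) ^ b)⁻¹ := by
      rw [← Real.inv_rpow (by positivity)]
      refine Real.rpow_le_rpow (by positivity) ?_ hb0.le
      rw [pow_succ, mul_inv]
      linarith
    rw [Real.mul_rpow (by norm_num) hx0.le] at h3
    have h4 := mul_le_mul_of_nonneg_right (min_le_left ((1 / 2 : ℝ) ^ b) (Φ ((2 : ℝ) ^ N)⁻¹)) hxb.le
    linarith
  · have h1 := hmono _ _ (hy N).le hxN.le
    have h2 : x ^ b ≤ 1 := Real.rpow_le_one hx0.le hx1 hb0.le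
    have h3 := mul_le_mul_of_nonneg_right (min_le_right ((1 / 2 : ℝ) ^ b) (Φ ((2 : ℝ) ^ N)⁻¹)) hxb.le
    have := hpos _ (hy N)
    nlinarith

/-- On `y ≥ 1` the integrand increases with the exponent, so convergence at infinity passes from
`a₀` to every smaller exponent. -/
lemma infOrOne_convergenceSet_Ioi_eq {Φ : ℝ → ℝ} (hpos : ∀ l, 0 < l → 0 < Φ l)
    (h : (convergenceSet Φ (Set.Ioi 0)).Nonempty) :
    infOrOne (convergenceSet Φ (Set.Ioi 0)) = infOrOne (convergenceSet Φ (Set.Ioc 0 1)) := by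
  obtain ⟨a₀, ha₀⟩ := h
  have hsub : convergenceSet Φ (Set.Ioi 0) ⊆ convergenceSet Φ (Set.Ioc 0 1) := fun a ha =>
    ⟨ha.1, ha.2.1, (lintegral_mono_set Set.Ioc_subset_Ioi_self).trans_lt ha.2.2⟩
  have hmin : ∀ a ∈ convergenceSet Φ (Set.Ioc 0 1), a ≤ a₀ → a ∈ convergenceSet Φ (Set.Ioi 0) := by
    intro a ha haa
    refine ⟨ha.1, ha.2.1, ?_⟩
    rw [← Set.Ioc_union_Ioi_eq_Ioi zero_le_one]
    refine (lintegral_union_le _ _ _).trans_lt (ENNReal.add_lt_top.2 ⟨ha.2.2, ?_⟩)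
    refine lt_of_le_of_lt ?_ ((lintegral_mono_set
      (Set.Ioi_subset_Ioi (zero_le_one (α := ℝ)))).trans_lt ha₀.2.2)
    refine setLIntegral_mono' measurableSet_Ioi fun y hy => ?_
    refine ENNReal.inv_le_inv.2 (ENNReal.ofReal_le_ofReal ?_)
    refine mul_le_mul_of_nonneg_right ?_ (hpos y (zero_lt_one.trans hy)).le
    exact Real.rpow_le_rpow_of_exponent_le (le_of_lt hy) (by linarith)
  refine le_antisymm ?_ ?_
  · rw [infOrOne.eq_def (convergenceSet Φ (Set.Ioc 0 1)), if_pos ⟨a₀, hsub ha₀⟩]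
    refine le_csInf ⟨a₀, hsub ha₀⟩ fun a ha => ?_
    rcases le_total a a₀ with haa | haa
    · exact infOrOne_le_of_mem (fun _ => convergenceSet_subset) (hmin a ha haa)
    · exact (infOrOne_le_of_mem (fun _ => convergenceSet_subset) ha₀).trans haa
  · rw [infOrOne.eq_def (convergenceSet Φ (Set.Ioi 0)), if_pos ⟨a₀, ha₀⟩]
    exact le_csInf ⟨a₀, ha₀⟩ fun a ha =>
      infOrOne_le_of_mem (fun _ => convergenceSet_subset) (hsub ha)

/-! ### Bounds for the Minkowski dimension -/

lemma logb_two_pow_rpow (n : ℕ) (b : ℝ) : Real.logb 2 (((2 : ℝ) ^ n) ^ b) = b * n := by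
  rw [Real.logb_rpow_eq_mul_logb_of_pos (by positivity), Real.logb_pow, Real.logb_self_eq_one]
  · simp
  · norm_num

lemma dimM_nonneg (F : Set ℝ) : 0 ≤ dimM F := by
  refine le_limsup_of_frequently_le (Eventually.of_forall fun n => ?_).frequently
  rw [EReal.coe_nonneg]
  refine mul_nonneg (by positivity) (Real.logb_nonneg (by norm_num) ?_)
  exact le_trans (by norm_num) (le_max_right _ _)

lemma dimM_le_of_eventually_ncard_le {F : Set ℝ} {b : ℝ} (hb : 0 < b)
    (h : ∀ᶠ n : ℕ in atTop, ((pix F ∩ box (2 ^ n)).ncard : ℝ) ≤ ((2 : ℝ) ^ n) ^ b) :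
    dimM F ≤ b := by
  refine limsup_le_of_le (by isBoundedDefault) ?_
  have h1 : ∀ᶠ n : ℕ in atTop, 1 ≤ b * n :=
    (tendsto_natCast_atTop_atTop.const_mul_atTop hb).eventually_ge_atTop 1
  filter_upwards [h, h1, eventually_gt_atTop 0] with n hn hn1 hn0
  have hn0' : (0 : ℝ) < n := by exact_mod_cast hn0
  rw [EReal.coe_le_coe_iff, inv_mul_le_iff₀ hn0', mul_comm, ← logb_two_pow_rpow, logPlus]
  refine Real.logb_le_logb_of_le (by norm_num) (by positivity) (max_le hn ?_)
  rw [← Real.rpow_natCast, ← Real.rpow_mul (by norm_num), mul_comm]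
  calc (2 : ℝ) = 2 ^ (1 : ℝ) := (Real.rpow_one 2).symm
    _ ≤ _ := Real.rpow_le_rpow_of_exponent_le (by norm_num) hn1

lemma dimM_range_le_one {f : ℝ≥0 → ℝ} (hf : ∀ t, 0 ≤ f t) : dimM (Set.range f) ≤ 1 := by
  refine dimM_le_of_eventually_ncard_le one_pos (Eventually.of_forall fun n => ?_)
  have hsub : pix (Set.range f) ∩ box (2 ^ n) ⊆ Finset.Ico (0 : ℤ) (2 ^ n) := by
    rintro k ⟨hk, -, hk2⟩
    obtain ⟨u, rfl⟩ := mem_pix_range_iff.1 hk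
    rw [Finset.coe_Ico]
    exact ⟨Int.floor_nonneg.2 (hf u), by exact_mod_cast hk2⟩
  have h := Set.ncard_le_ncard hsub (Finset.finite_toSet _)
  rw [Set.ncard_coe_finset, Int.card_Ico, sub_zero] at h
  rw [Real.rpow_one]
  have h2 : (((2 : ℤ) ^ n).toNat : ℝ) = 2 ^ n := by
    have : ((2 : ℤ) ^ n).toNat = 2 ^ n := by
      rw [show (2 : ℤ) ^ n = ((2 ^ n : ℕ) : ℤ) by push_cast; rfl, Int.toNat_natCast]
    rw [this]
    push_cast
    rfl
  rw [← h2]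
  exact_mod_cast h

lemma le_dimM_of_frequently_le_ncard {F : Set ℝ} {b c : ℝ} (hc : 0 < c)
    (h : ∃ᶠ n : ℕ in atTop, c * ((2 : ℝ) ^ n) ^ b ≤ (pix F ∩ box (2 ^ n)).ncard) :
    (b : EReal) ≤ dimM F := by
  refine EReal.ge_of_forall_gt_iff_ge.1 fun z hz => ?_
  rw [EReal.coe_lt_coe_iff] at hz
  refine le_limsup_of_frequently_le ?_
  have h1 : ∀ᶠ n : ℕ in atTop, -Real.logb 2 c ≤ (b - z) * n :=
    (tendsto_natCast_atTop_atTop.const_mul_atTop (sub_pos.2 hz)).eventually_ge_atTop _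
  refine (h.and_eventually (h1.and (eventually_gt_atTop 0))).mono ?_
  rintro n ⟨hn, hn1, hn0⟩
  have hn0' : (0 : ℝ) < n := by exact_mod_cast hn0
  rw [EReal.coe_le_coe_iff, le_inv_mul_iff₀ hn0', logPlus]
  have h2 : Real.logb 2 (c * ((2 : ℝ) ^ n) ^ b) ≤
      Real.logb 2 (max ((pix F ∩ box (2 ^ n)).ncard : ℝ) 2) :=
    Real.logb_le_logb_of_le (by norm_num) (by positivity) (hn.trans (le_max_left _ _))
  rw [Real.logb_mul hc.ne' (by positivity), logb_two_pow_rpow] at h2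
  linarith

lemma summable_two_pow_rpow_neg {e : ℝ} (he : 0 < e) :
    Summable fun n : ℕ => ((2 : ℝ) ^ n) ^ (-e) := by
  have h : ∀ n : ℕ, ((2 : ℝ) ^ n) ^ (-e) = ((2 : ℝ) ^ (-e)) ^ n := fun n => by
    rw [← Real.rpow_natCast, ← Real.rpow_natCast, ← Real.rpow_mul (by norm_num),
      ← Real.rpow_mul (by norm_num), mul_comm]
  simp_rw [h]
  refine summable_geometric_of_lt_one (by positivity) ?_
  exact Real.rpow_lt_one_of_one_lt_of_neg (by norm_num) (by linarith)

/-! ### The dimension of the range of a subordinator -/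

/-- Up to an exponentially small probability, the level `2 ^ n` is passed by time
`t = 2 ^ (n (a + e))`, and at most `2 ^ (n e) t` pixels are visited before; here `b = a + 2 e`. -/
lemma IsSubordinator.ae_dimM_range_le (hX : IsSubordinator X P) (hΦ : IsLaplaceExponent Φ X P)
    (hpos : 0 < P {ω | 0 < X 1 ω}) {a b : ℝ} (ha : a ∈ convergenceSet Φ (Set.Ioc 0 1))
    (hab : a < b) :
    ∀ᵐ ω ∂P, dimM (Set.range fun t => X t ω) ≤ b := by
  have hΦpos : ∀ l, 0 < l → 0 < Φ l := fun l => hX.laplace_pos hΦ hpos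
  obtain ⟨c, hc, hcΦ⟩ := exists_mul_rpow_le_of_mem_convergenceSet
    (fun l l' => hX.laplace_mono hΦ) hΦpos ha
  have ha0 := ha.1
  obtain ⟨e, he, rfl⟩ : ∃ e > 0, b = a + e + e := ⟨(b - a) / 2, by linarith, by ring⟩
  have hr1 : ∀ n : ℕ, (1 : ℝ) ≤ 2 ^ n := fun n => one_le_pow₀ (by norm_num)
  have hr0 : ∀ n : ℕ, (0 : ℝ) < 2 ^ n := fun n => by positivity
  set t : ℕ → ℝ≥0 := fun n => Real.toNNReal (((2 : ℝ) ^ n) ^ (a + e)) with ht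
  have htv : ∀ n, (t n : ℝ) = ((2 : ℝ) ^ n) ^ (a + e) := fun n =>
    Real.coe_toNNReal _ (by positivity)
  have ht1 : ∀ n, (1 : ℝ) ≤ t n := fun n => by
    rw [htv]
    exact Real.one_le_rpow (hr1 n) (by linarith)
  have hlate : ∀ n, P.real {ω | X (t n) ω < 2 ^ n} ≤ 3 / c * ((2 : ℝ) ^ n) ^ (-e) := by
    intro n
    have ht0 : 0 < t n := by exact_mod_cast zero_lt_one.trans_le (ht1 n)
    refine (hX.measureReal_lt_le hΦ hpos ht0 (hr0 n)).trans ?_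
    have h1 := hcΦ ((2 : ℝ) ^ n)⁻¹ (by positivity) (inv_le_one_of_one_le₀ (hr1 n))
    have h2 : c * ((2 : ℝ) ^ n) ^ e ≤ t n * Φ ((2 : ℝ) ^ n)⁻¹ := by
      refine le_trans (le_of_eq ?_) (mul_le_mul_of_nonneg_left h1 (t n).2)
      rw [htv, Real.inv_rpow (hr0 n).le, Real.rpow_add (hr0 n)]
      field_simp
    rw [Real.rpow_neg (hr0 n).le, div_mul_eq_mul_div, mul_inv_eq_iff_eq_mul₀ (by positivity) |>.2
      (by field_simp : (3 : ℝ) = 3 / ((2 : ℝ) ^ n) ^ e * ((2 : ℝ) ^ n) ^ e), div_div,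
      mul_comm (((2 : ℝ) ^ n) ^ e)]
    exact div_le_div_of_nonneg_left (by norm_num) (by positivity) h2
  have hmany : ∀ n, P.real {ω | ENNReal.ofReal (((2 : ℝ) ^ n) ^ (a + e + e)) ≤ liminf (fun j =>
      ENNReal.ofReal (2 + 4 * expVariation (fun u => X u ω) (t n) j)) atTop} ≤
      (2 + 4 * Φ 1) * ((2 : ℝ) ^ n) ^ (-e) := by
    intro n
    refine (hX.measureReal_liminf_expVariation_le hΦ (hΦpos 1 one_pos).le (t n)
      (by positivity)).trans ?_
    rw [div_le_iff₀ (by positivity), mul_assoc, ← Real.rpow_add (hr0 n),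
      show -e + (a + e + e) = a + e by ring, ← htv]
    nlinarith [ht1 n]
  filter_upwards [hX.monotone, hX.cadlag,
    ae_eventually_notMem_of_summable hlate ((summable_two_pow_rpow_neg he).mul_left _),
    ae_eventually_notMem_of_summable hmany ((summable_two_pow_rpow_neg he).mul_left _)]
    with ω hm hcad h1 h2
  refine dimM_le_of_eventually_ncard_le (by linarith) ?_
  filter_upwards [h1, h2] with n hn1 hn2
  have hev := eventually_ncard_le hm hcad.1 (not_lt.1 hn1)
  have hle := le_liminf_of_le (by isBoundedDefault)
    (hev.mono fun j hj => ENNReal.ofReal_le_ofReal hj)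
  have hlt := hle.trans_lt (not_le.1 hn2)
  exact ((ENNReal.ofReal_lt_ofReal_iff (by positivity)).1 hlt).le

/-- Along a subsequence of levels, the process stays below `2 ^ n` up to a time of order
`2 ^ (n b)`, and by then it has made a positive proportion of increments of size at least one. -/
lemma IsSubordinator.ae_le_dimM_range (hX : IsSubordinator X P) (hΦ : IsLaplaceExponent Φ X P)
    (hpos : 0 < P {ω | 0 < X 1 ω}) {a b : ℝ} (ha : a ∉ convergenceSet Φ (Set.Ioc 0 1))
    (hb0 : 0 < b) (hba : b < a) (ha1 : a < 1) :
    ∀ᵐ ω ∂P, (b : EReal) ≤ dimM (Set.range fun t => X t ω) := by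
  have hΦpos : ∀ l, 0 < l → 0 < Φ l := fun l => hX.laplace_pos hΦ hpos
  obtain ⟨e, he, hbe⟩ : ∃ e > 0, b + e < a := ⟨(a - b) / 2, by linarith, by linarith⟩
  have hfreq := frequently_le_of_notMem_convergenceSet
    (fun l l' => hX.laplace_mono hΦ) hΦpos (by linarith) hbe ha1 ha
  obtain ⟨s, hs⟩ := hX.exists_measureReal_one_le_sub_pos hΦ (hΦpos 1 one_pos)
  set p := P.real {ω | 1 ≤ X s ω - X 0 ω} with hp
  have hr1 : ∀ n : ℕ, (1 : ℝ) ≤ 2 ^ n := fun n => one_le_pow₀ (by norm_num)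
  have hr0 : ∀ n : ℕ, (0 : ℝ) < 2 ^ n := fun n => by positivity
  set M : ℕ → ℕ := fun n => ⌈((2 : ℝ) ^ n) ^ b⌉₊ with hM
  have hMle : ∀ n, (M n : ℝ) ≤ 2 * ((2 : ℝ) ^ n) ^ b := by
    intro n
    have h1 := Nat.ceil_lt_add_one (a := ((2 : ℝ) ^ n) ^ b) (by positivity)
    have h2 : (1 : ℝ) ≤ ((2 : ℝ) ^ n) ^ b := Real.one_le_rpow (hr1 n) hb0.le
    simp only [hM]
    linarith
  have hMtop : Tendsto M atTop atTop :=
    tendsto_nat_ceil_atTop.comp ((tendsto_rpow_atTop hb0).comp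
      (tendsto_pow_atTop_atTop_of_one_lt (by norm_num)))
  -- The event is empty unless `n` belongs to the subsequence along which `Φ` is small.
  have hearly : ∀ n, P.real {ω | Φ ((2 : ℝ) ^ n)⁻¹ ≤ (((2 : ℝ) ^ n) ^ (b + e))⁻¹ ∧
      2 ^ n ≤ X ((M n : ℝ≥0) * s) ω} ≤ (4 * s) * ((2 : ℝ) ^ n) ^ (-e) := by
    intro n
    by_cases hn : Φ ((2 : ℝ) ^ n)⁻¹ ≤ (((2 : ℝ) ^ n) ^ (b + e))⁻¹
    · simp only [hn, true_and]
      refine (hX.measureReal_ge_le hΦ _ (hr0 n)).trans ?_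
      have hs0 : (0 : ℝ) ≤ s := s.2
      push_cast
      calc 2 * ((M n : ℝ) * s * Φ ((2 : ℝ) ^ n)⁻¹)
          ≤ 2 * (2 * ((2 : ℝ) ^ n) ^ b * s * (((2 : ℝ) ^ n) ^ (b + e))⁻¹) := by
            have := (hΦpos ((2 : ℝ) ^ n)⁻¹ (by positivity)).le
            gcongr
            exact hMle n
        _ = 4 * s * ((2 : ℝ) ^ n) ^ (-e) := by
            rw [Real.rpow_add (hr0 n), Real.rpow_neg (hr0 n).le]
            field_simp
            ring
    · simp only [hn, false_and, Set.ofPred_false, measureReal_empty]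
      positivity
  filter_upwards [hX.monotone, hX.zero, hX.ae_tendsto_card_filter_div s,
    ae_eventually_notMem_of_summable hearly ((summable_two_pow_rpow_neg he).mul_left _)]
    with ω hm h0 hslln hev
  have hcard := (hslln.comp hMtop).eventually_const_le (half_lt_self hs)
  refine le_dimM_of_frequently_le_ncard (half_pos hs) ?_
  refine (hfreq.and_eventually (hev.and hcard)).mono ?_
  rintro n ⟨hn, hnot, hn2⟩
  have hlt : X ((M n : ℝ≥0) * s) ω < 2 ^ n := not_le.1 fun h => hnot ⟨hn, h⟩
  have hceil : ((2 : ℝ) ^ n) ^ b ≤ M n := Nat.le_ceil _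
  have hM0 : (0 : ℝ) < M n := lt_of_lt_of_le (by positivity) hceil
  simp only [Function.comp] at hn2
  rw [le_div_iff₀ hM0] at hn2
  have h1 := card_filter_le_ncard hm h0.ge hlt
  have h2 : _ ≤ ((pix (Set.range fun t => X t ω) ∩ box (2 ^ n)).ncard : ℝ) := Nat.cast_le.2 h1
  exact (mul_le_mul_of_nonneg_left hceil (half_pos hs).le).trans (hn2.trans h2)

lemma IsSubordinator.ae_dimM_range_eq (hX : IsSubordinator X P) (hΦ : IsLaplaceExponent Φ X P)
    (hpos : 0 < P {ω | 0 < X 1 ω}) :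
    ∀ᵐ ω ∂P, dimM (Set.range fun t => X t ω) =
      (infOrOne (convergenceSet Φ (Set.Ioc 0 1)) : EReal) := by
  set I := infOrOne (convergenceSet Φ (Set.Ioc 0 1)) with hI
  have hsub : ∀ a ∈ convergenceSet Φ (Set.Ioc 0 1), 0 < a ∧ a < 1 := fun _ => convergenceSet_subset
  have hI1 : I ≤ 1 := infOrOne_le_one hsub
  have hnn : ∀ᵐ ω ∂P, ∀ t, 0 ≤ X t ω := by
    filter_upwards [hX.zero, hX.monotone] with ω h0 hm t
    rw [← h0]
    exact hm zero_le
  have hup : ∀ᵐ ω ∂P, ∀ q : ℚ, I < q → dimM (Set.range fun t => X t ω) ≤ ((q : ℝ) : EReal) := by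
    refine ae_all_iff.2 fun q => ?_
    by_cases hq : I < q
    · rcases exists_mem_lt_or_one_lt_of_infOrOne_lt hq with ⟨a, ha, haq⟩ | h1
      · exact (hX.ae_dimM_range_le hΦ hpos ha haq).mono fun ω h _ => h
      · filter_upwards [hnn] with ω hω _
        refine (dimM_range_le_one hω).trans ?_
        exact_mod_cast h1.le
    · exact Eventually.of_forall fun ω h => absurd h hq
  have hlow : ∀ᵐ ω ∂P, ∀ q : ℚ, (q : ℝ) < I →
      ((q : ℝ) : EReal) ≤ dimM (Set.range fun t => X t ω) := by
    refine ae_all_iff.2 fun q => ?_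
    by_cases hq : (q : ℝ) < I
    · rcases le_or_gt (q : ℝ) 0 with hq0 | hq0
      · refine Eventually.of_forall fun ω _ => le_trans ?_ (dimM_nonneg _)
        exact_mod_cast hq0
      · obtain ⟨a, hqa, haI⟩ := exists_between hq
        have ha : a ∉ convergenceSet Φ (Set.Ioc 0 1) := fun h =>
          (infOrOne_le_of_mem hsub h).not_gt haI
        exact (hX.ae_le_dimM_range hΦ hpos ha hq0 hqa (haI.trans_le hI1)).mono fun ω h _ => h
    · exact Eventually.of_forall fun ω h => absurd h hq
  filter_upwards [hup, hlow] with ω h1 h2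
  refine le_antisymm ?_ ?_
  · by_contra! h
    obtain ⟨q, hq1, hq2⟩ := EReal.lt_iff_exists_rat_btwn.1 h
    exact (h1 q (by exact_mod_cast hq1)).not_gt hq2
  · by_contra! h
    obtain ⟨q, hq1, hq2⟩ := EReal.lt_iff_exists_rat_btwn.1 h
    exact (h2 q (by exact_mod_cast hq2)).not_gt hq1

end MacroDim

theorem mainTheorem6 {Ω : Type*} [MeasurableSpace Ω] (P : Measure Ω) [IsProbabilityMeasure P]
    (X : ℝ≥0 → Ω → ℝ) (hX : MacroDim.IsSubordinator X P) (hpos : 0 < P {ω | 0 < X 1 ω})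
    (Φ : ℝ → ℝ) (hΦ : MacroDim.IsLaplaceExponent Φ X P) :
    (∀ᵐ ω ∂P, MacroDim.dimM (Set.range fun t => X t ω) =
      (MacroDim.infOrOne (MacroDim.convergenceSet Φ (Set.Ioc 0 1)) : EReal)) ∧
    ((MacroDim.convergenceSet Φ (Set.Ioi 0)).Nonempty →
      ∀ᵐ ω ∂P, MacroDim.dimM (Set.range fun t => X t ω) =
        (MacroDim.infOrOne (MacroDim.convergenceSet Φ (Set.Ioi 0)) : EReal)) := by
  refine ⟨hX.ae_dimM_range_eq hΦ hpos, fun h => ?_⟩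
  rw [MacroDim.infOrOne_convergenceSet_Ioi_eq (fun _ => hX.laplace_pos hΦ hpos) h]
  exact hX.ae_dimM_range_eq hΦ hpos
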